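/- Let $d,n\in\mathbb{N}$, $n\ge 1$, let $\mathcal Z$ be a set and let $f:\mathbb{R}^d\times\mathcal Z\to\mathbb{R}$ be such that $f(\cdot;z)$ is differentiable for every $z\in\mathcal Z$ and $$\|\nabla f(w;z)-\nabla f(w;z')\|\le L\qquad\text{for all } z,z'\in\mathcal Z,\ w\in\mathbb{R}^d .$$ Let $\beta,\sigma_0>0$ and let $\eta_0,\dots,\eta_{N-1}>0$ be step sizes. For a dataset $S=(z_1,\dots,z_n)\in\mathcal Z^n$, the SGLD iterates are defined by $w_0\sim\mathcal N(0,\sigma_0^2I_d)$ and $$w_{k+1}=w_k-\eta_k\nabla f(w_k;z_{i_k})+\sqrt{\tfrac{2\eta_k}{\beta}}\,B_k,\qquad i_k\sim\mathcal U\{1,\dots,n\},\quad B_k\sim\mathcal N(0,I_d),$$ where $w_0$ and all the $i_k,B_k$ are independent. For two densities $p,q$ on $\mathbb{R}^d$ let $D_H(p\|q)=\frac12\int_{\mathbb{R}^d}(\sqrt p-\sqrt q)^2\,dw$ be the squared Hellinger distance. Let $S,S'\in\mathcal Z^n$ be neighboring datasets, that is, datasets that differ in exactly one data point. Suppose that $\eta_k\le\frac{\ln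 2}{\beta L^2}$ for all $0\le k<N$ (no condition if $L=0$). Then the laws of the $N$-th SGLD iterates on $S$ and on $S'$ have Lebesgue densities $p_N$ and $p_N'$, and $$\sqrt{D_H(p_N\|p_N')}\le\frac{\sqrt\beta\,L}{2n}\Bigl(\sum_{k=0}^{N-1}\eta_k\Bigr)^{1/2}.$$ -/

import Mathlib

open MeasureTheory ProbabilityTheory

/-- The squared Hellinger distance `(1/2) ∫ (√p - √q)²` between two densities on `ℝᵈ`. -/
noncomputable def hellingerSq {d : ℕ} (p q : EuclideanSpace ℝ (Fin d) → ℝ) : ℝ :=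
  1 / 2 * ∫ w, (√(p w) - √(q w)) ^ 2

/-- Two datasets of size `n` are neighboring if they differ in exactly one data point. -/
def Neighboring {𝒵 : Type*} {n : ℕ} (S S' : Fin n → 𝒵) : Prop :=
  ∃! i, S i ≠ S' i

/-- One SGLD update from the point `w`, with step size `η`, inverse temperature `β`, sampled data
point `z`, and a standard Gaussian vector realized as `b`:
`w - η ∇f(w; z) + √(2η/β) b`. -/
noncomputable def sgldStep {𝒵 : Type*} {d : ℕ} (f : EuclideanSpace ℝ (Fin d) → 𝒵 → ℝ)
    (β η : ℝ) (w : EuclideanSpace ℝ (Fin d)) (z : 𝒵) (b : EuclideanSpace ℝ (Fin d)) :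
    EuclideanSpace ℝ (Fin d) :=
  w - η • gradient (fun v => f v z) w + √(2 * η / β) • b

/-- The law of the SGLD iterate `w_k` run on the dataset `S`. The initial point is
`w_0 ∼ N(0, σ₀² I_d)`, and `w_{k+1}` is obtained from `w_k` by one update in which the index `i_k`
is uniform on `{1, …, n}`, the noise `B_k ∼ N(0, I_d)`, and `w_k`, `i_k`, `B_k` are independent. -/
noncomputable def sgldLaw {𝒵 : Type*} {d n : ℕ} (f : EuclideanSpace ℝ (Fin d) → 𝒵 → ℝ)
    (S : Fin n → 𝒵) (β σ₀ : ℝ) (η : ℕ → ℝ) : ℕ → Measure (EuclideanSpace ℝ (Fin d))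
  | 0 => (stdGaussian (EuclideanSpace ℝ (Fin d))).map (fun x => σ₀ • x)
  | k + 1 =>
      ((sgldLaw f S β σ₀ η k).prod ((uniformOn (Set.univ : Set (Fin n))).prod
        (stdGaussian (EuclideanSpace ℝ (Fin d))))).map
        (fun x => sgldStep f β (η k) x.1 (S x.2.1) x.2.2)

/-- The density `p_k` of the SGLD iterate `w_k` with respect to Lebesgue measure. -/
noncomputable def sgldDensity {𝒵 : Type*} {d n : ℕ} (f : EuclideanSpace ℝ (Fin d) → 𝒵 → ℝ)
    (S : Fin n → 𝒵) (β σ₀ : ℝ) (η : ℕ → ℝ) (k : ℕ) (w : EuclideanSpace ℝ (Fin d)) : ℝ :=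
  ((sgldLaw f S β σ₀ η k).rnDeriv volume w).toReal

/-! For probability densities the squared Hellinger distance is one minus the affinity `∫ √p √q`, so
it suffices to bound the affinity from below by `1 - β L² / (4 n²) · ∑ η k`.

Affinity tensorizes along a Markov chain. If the two transition densities have affinity at least `c`
from every starting point, then integrating over the joint law of consecutive iterates and applying
Cauchy–Schwarz in the starting point shows that one step multiplies the affinity by at least `c`
(`mul_hellingerAffinity_le`). The chains start from the same law, and a product of factors `1 - a k`
with `0 ≤ a k ≤ 1` is at least `1 - ∑ a k`.

For one step, the kernels `P`, `Q` are uniform mixtures of `n` Gaussians with precision `2 b`, `b =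
β / (4 η)`, differing in one component `j`; all means lie within `δ = η L` of each other. The
geometric mean dominates the harmonic mean, so `√(P Q) ≥ (P + Q) / 2 - (P - Q)² / (2 (P + Q))`. Here
`P - Q` is `1 / n` times a difference of two Gaussians, and convexity of the inverse replaces the
mixture in the denominator by an average over single Gaussians. What remains is an explicit χ²-type
integral of size at most `4 b δ²`, so the loss is at most `b δ² / n² = β L² η / (4 n²)`
(`one_sub_le_lintegral_gaussMixture`). -/

/-! ### Isotropic Gaussian densities -/

section GaussianDensity

open scoped RealInnerProductSpace ENNReal

variable {V : Type*} [NormedAddCommGroup V] [InnerProductSpace ℝ V]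

/-- The density of the isotropic Gaussian measure with mean `m` and precision `2 * b`. -/
noncomputable def gaussDensity (b : ℝ) (m y : V) : ℝ :=
  ((Real.pi / b) ^ (Module.finrank ℝ V / 2 : ℝ))⁻¹ * Real.exp (-b * ‖y - m‖ ^ 2)

lemma gaussDensity_pos {b : ℝ} (hb : 0 < b) (m y : V) : 0 < gaussDensity b m y := by
  unfold gaussDensity
  positivity

lemma continuous_gaussDensity (b : ℝ) :
    Continuous fun p : V × V => gaussDensity b p.1 p.2 := by
  unfold gaussDensity
  fun_prop

/-- Completing the square: the exponent is again quadratic with leading coefficient `-b`, so the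
quotient is a multiple of a Gaussian and integrates explicitly. -/
lemma gaussDensity_mul_div {b : ℝ} (hb : 0 < b) (x y c v : V) :
    gaussDensity b x v * gaussDensity b y v / gaussDensity b c v =
      Real.exp (2 * b * ⟪x - c, y - c⟫) * gaussDensity b (x + y - c) v := by
  rw [div_eq_iff (gaussDensity_pos hb c v).ne']
  unfold gaussDensity
  set K := ((Real.pi / b) ^ (Module.finrank ℝ V / 2 : ℝ))⁻¹
  have key : -b * ‖v - x‖ ^ 2 + -b * ‖v - y‖ ^ 2 =
      2 * b * ⟪x - c, y - c⟫ + -b * ‖v - (x + y - c)‖ ^ 2 + -b * ‖v - c‖ ^ 2 := by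
    have e1 : v - x = (v - c) - (x - c) := by abel
    have e2 : v - y = (v - c) - (y - c) := by abel
    have e3 : v - (x + y - c) = (v - c) - ((x - c) + (y - c)) := by abel
    rw [e1, e2, e3]
    generalize v - c = p, x - c = q, y - c = r
    rw [norm_sub_sq_real, norm_sub_sq_real, norm_sub_sq_real, norm_add_sq_real, inner_add_right]
    ring
  calc K * Real.exp (-b * ‖v - x‖ ^ 2) * (K * Real.exp (-b * ‖v - y‖ ^ 2))
      = K * K * Real.exp (-b * ‖v - x‖ ^ 2 + -b * ‖v - y‖ ^ 2) := by rw [Real.exp_add]; ring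
    _ = _ := by rw [key, Real.exp_add, Real.exp_add]; ring

variable [FiniteDimensional ℝ V] [MeasurableSpace V] [BorelSpace V]

lemma Measurable.gaussDensity {α : Type*} [MeasurableSpace α] (b : ℝ) {g h : α → V}
    (hg : Measurable g) (hh : Measurable h) :
    Measurable fun x => gaussDensity b (g x) (h x) :=
  (continuous_gaussDensity b).measurable.comp (hg.prodMk hh)

lemma integrable_exp_neg_mul_sq_norm {b : ℝ} (hb : 0 < b) :
    Integrable fun v : V => Real.exp (-b * ‖v‖ ^ 2) := by
  have h := (GaussianFourier.integrable_cexp_neg_mul_sq_norm_add (b := (b : ℂ)) (by simpa) 0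
    (0 : V)).re
  refine h.congr (.of_forall fun v => ?_)
  have : (-(b : ℂ) * (‖v‖ : ℂ) ^ 2 + 0 * ((⟪(0 : V), v⟫ : ℝ) : ℂ)) =
      ((-b * ‖v‖ ^ 2 : ℝ) : ℂ) := by
    push_cast
    ring
  change (Complex.exp _).re = _
  rw [this, Complex.exp_ofReal_re]

lemma integrable_gaussDensity {b : ℝ} (hb : 0 < b) (m : V) : Integrable (gaussDensity b m) :=
  ((integrable_exp_neg_mul_sq_norm hb).comp_sub_right m).const_mul _

lemma integral_gaussDensity {b : ℝ} (hb : 0 < b) (m : V) : ∫ y, gaussDensity b m y = 1 := by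
  unfold gaussDensity
  rw [integral_const_mul, integral_sub_right_eq_self (fun v : V => Real.exp (-b * ‖v‖ ^ 2)) m,
    GaussianFourier.integral_rexp_neg_mul_sq_norm hb]
  exact inv_mul_cancel₀ (by positivity)

lemma lintegral_gaussDensity {b : ℝ} (hb : 0 < b) (m : V) :
    ∫⁻ y, ENNReal.ofReal (gaussDensity b m y) = 1 := by
  rw [← ofReal_integral_eq_lintegral_ofReal (integrable_gaussDensity hb m)
    (.of_forall fun y => (gaussDensity_pos hb m y).le), integral_gaussDensity hb, ENNReal.ofReal_one]

/-- Both sides are finite measures with the same characteristic function, by the complex Gaussian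
integral. -/
lemma map_smul_stdGaussian {s : ℝ} (hs : 0 < s) :
    (stdGaussian V).map (fun x => s • x) =
      volume.withDensity fun y => ENNReal.ofReal (gaussDensity (1 / (2 * s ^ 2)) (0 : V) y) := by
  set b : ℝ := 1 / (2 * s ^ 2) with hbdef
  have hb : 0 < b := by positivity
  have hm : Measurable fun y : V => (gaussDensity b (0 : V) y).toNNReal :=
    (Measurable.gaussDensity b measurable_const measurable_id).real_toNNReal
  have hfin : IsFiniteMeasure
      (volume.withDensity fun y => ENNReal.ofReal (gaussDensity b (0 : V) y)) :=
    isFiniteMeasure_withDensity (by rw [lintegral_gaussDensity hb]; simp)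
  have hfin' : IsFiniteMeasure ((stdGaussian V).map (fun x => s • x)) := inferInstance
  refine Measure.ext_of_charFun ?_
  ext t
  rw [charFun_map_smul, charFun_stdGaussian, charFun_apply]
  have := integral_withDensity_eq_integral_smul (μ := (volume : Measure V)) hm
    (fun x => Complex.exp (⟪x, t⟫ * Complex.I))
  change _ = ∫ x, Complex.exp (⟪x, t⟫ * Complex.I) ∂(volume.withDensity
    fun y => (((gaussDensity b (0 : V) y).toNNReal : NNReal) : ℝ≥0∞))
  rw [this]
  have h2 := GaussianFourier.integral_cexp_neg_mul_sq_norm_add (b := (b : ℂ)) (by simpa) Complex.I t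
  have hpt : ∀ x : V, (gaussDensity b (0 : V) x).toNNReal • Complex.exp (⟪x, t⟫ * Complex.I) =
      (((Real.pi / b) ^ (Module.finrank ℝ V / 2 : ℝ))⁻¹ : ℝ) *
        Complex.exp (-b * ‖x‖ ^ 2 + Complex.I * ⟪t, x⟫) := by
    intro x
    rw [NNReal.smul_def, Real.coe_toNNReal _ (gaussDensity_pos hb _ _).le, Complex.real_smul,
      gaussDensity, sub_zero, Complex.exp_add, real_inner_comm, mul_comm Complex.I]
    push_cast
    ring
  simp_rw [hpt]
  rw [integral_const_mul, h2]
  have hc : ((Real.pi / b : ℂ)) ^ (Module.finrank ℝ V / 2 : ℂ) =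
      (((Real.pi / b) ^ (Module.finrank ℝ V / 2 : ℝ) : ℝ) : ℂ) := by
    rw [Complex.ofReal_cpow (by positivity)]
    push_cast
    rfl
  rw [hc, ← mul_assoc, ← Complex.ofReal_mul, inv_mul_cancel₀ (by positivity), Complex.ofReal_one,
    one_mul, norm_smul, Complex.I_sq, hbdef]
  congr 1
  have : (s : ℂ) ≠ 0 := by exact_mod_cast hs.ne'
  rw [Real.norm_of_nonneg hs.le]
  push_cast
  field_simp
  norm_num

lemma lintegral_stdGaussian_add_smul {s : ℝ} (hs : 0 < s) (m : V) {h : V → ℝ≥0∞}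
    (hh : Measurable h) :
    ∫⁻ b, h (m + s • b) ∂(stdGaussian V) =
      ∫⁻ y, ENNReal.ofReal (gaussDensity (1 / (2 * s ^ 2)) m y) * h y := by
  have h1 : ∫⁻ b, h (m + s • b) ∂(stdGaussian V) =
      ∫⁻ y, h (m + y) ∂((stdGaussian V).map (fun x => s • x)) := by
    rw [lintegral_map (by fun_prop) (by fun_prop)]
  have hmeas : Measurable fun y : V =>
      ENNReal.ofReal (gaussDensity (1 / (2 * s ^ 2)) (0 : V) y) :=
    (Measurable.gaussDensity _ measurable_const measurable_id).ennreal_ofReal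
  rw [h1, map_smul_stdGaussian hs, lintegral_withDensity_eq_lintegral_mul _ hmeas (by fun_prop),
    ← lintegral_add_left_eq_self (fun y => ENNReal.ofReal (gaussDensity _ m y) * h y) m]
  refine lintegral_congr fun y => ?_
  simp [gaussDensity]

end GaussianDensity

/-! ### Affinity of Gaussian mixtures differing in one component -/

section MixtureAffinity

open scoped RealInnerProductSpace ENNReal

lemma sub_sq_div_le_sqrt_mul {p q : ℝ} (hp : 0 < p) (hq : 0 < q) :
    (p + q) / 2 - (p - q) ^ 2 / (2 * (p + q)) ≤ √(p * q) := by
  have h : (p + q) / 2 - (p - q) ^ 2 / (2 * (p + q)) = 2 * (p * q) / (p + q) := by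
    field_simp
    ring
  rw [h, div_le_iff₀ (by positivity), Real.sqrt_mul hp.le]
  have h1 := Real.sq_sqrt hp.le
  have h2 := Real.sq_sqrt hq.le
  have h3 := Real.sqrt_nonneg p
  have h4 := Real.sqrt_nonneg q
  generalize √p = a at *
  generalize √q = c at *
  subst h1 h2
  nlinarith [mul_nonneg (mul_nonneg h3 h4) (sq_nonneg (a - c))]

/-- Cauchy–Schwarz in Engel form. It removes mixtures from denominators. -/
lemma inv_mean_le_mean_inv {ι : Type*} [Fintype ι] [Nonempty ι] {u : ι → ℝ} (hu : ∀ i, 0 < u i) :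
    ((Fintype.card ι : ℝ)⁻¹ * ∑ i, u i)⁻¹ ≤ (Fintype.card ι : ℝ)⁻¹ * ∑ i, (u i)⁻¹ := by
  have h := Finset.sq_sum_div_le_sum_sq_div Finset.univ (fun _ : ι => (1 : ℝ))
    (g := u) (fun i _ => hu i)
  simp only [Finset.sum_const, Finset.card_univ, nsmul_eq_mul, mul_one, one_pow, one_div] at h
  have hs : 0 < ∑ i, u i := Finset.sum_pos (fun i _ => hu i) Finset.univ_nonempty
  have hc : (0 : ℝ) < Fintype.card ι := by exact_mod_cast Fintype.card_pos
  calc ((Fintype.card ι : ℝ)⁻¹ * ∑ i, u i)⁻¹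
      = (Fintype.card ι : ℝ)⁻¹ * ((Fintype.card ι : ℝ) ^ 2 / ∑ i, u i) := by
        field_simp
    _ ≤ _ := by gcongr

lemma inv_add_le {p q : ℝ} (hp : 0 < p) (hq : 0 < q) : (p + q)⁻¹ ≤ (p⁻¹ + q⁻¹) / 4 := by
  have h : (p⁻¹ + q⁻¹) / 4 - (p + q)⁻¹ = (p - q) ^ 2 / (4 * p * q * (p + q)) := by
    field_simp
    ring
  have : 0 ≤ (p - q) ^ 2 / (4 * p * q * (p + q)) := by positivity
  linarith

variable {V : Type*} [NormedAddCommGroup V] [InnerProductSpace ℝ V]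

lemma gaussDensity_sub_sq_div {b : ℝ} (hb : 0 < b) (x y c v : V) :
    (gaussDensity b x v - gaussDensity b y v) ^ 2 / gaussDensity b c v =
      Real.exp (2 * b * ⟪x - c, x - c⟫) * gaussDensity b (x + x - c) v +
        Real.exp (2 * b * ⟪y - c, y - c⟫) * gaussDensity b (y + y - c) v -
          2 * (Real.exp (2 * b * ⟪x - c, y - c⟫) * gaussDensity b (x + y - c) v) := by
  rw [← gaussDensity_mul_div hb, ← gaussDensity_mul_div hb, ← gaussDensity_mul_div hb]
  ring

lemma exp_add_exp_sub_two_mul_exp_inner_le {b δ : ℝ} (hb : 0 < b) (hδ : 2 * b * δ ^ 2 ≤ 1 / 2)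
    {p q : V} (hp : ‖p‖ ≤ δ) (hq : ‖q‖ ≤ δ) (hpq : ‖p - q‖ ≤ δ) :
    Real.exp (2 * b * ⟪p, p⟫) + Real.exp (2 * b * ⟪q, q⟫) - 2 * Real.exp (2 * b * ⟪p, q⟫) ≤
      4 * b * δ ^ 2 := by
  have key : ∀ r : V, ‖r‖ ≤ δ → Real.exp (2 * b * ⟪r, r⟫) ≤ 1 + 3 / 2 * (2 * b * ‖r‖ ^ 2) := by
    intro r hr
    rw [real_inner_self_eq_norm_sq]
    have h1 : ‖r‖ ^ 2 ≤ δ ^ 2 := by gcongr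
    have h0 : 0 ≤ 2 * b * ‖r‖ ^ 2 := by positivity
    have h2 : 2 * b * ‖r‖ ^ 2 ≤ 1 / 2 := le_trans (by gcongr) hδ
    generalize 2 * b * ‖r‖ ^ 2 = t at h0 h2
    -- For `0 ≤ t ≤ 1/2`, `exp t ≤ 1 + t + t² ≤ 1 + 3 t / 2`.
    have h3 := (abs_le.1 (Real.abs_exp_sub_one_sub_id_le (x := t)
      (by rw [abs_of_nonneg h0]; linarith))).2
    nlinarith
  have h1 := key p hp
  have h2 := key q hq
  have h3 := Real.add_one_le_exp (2 * b * ⟪p, q⟫)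
  have h4 := norm_sub_sq_real p q
  have hp2 : ‖p‖ ^ 2 ≤ δ ^ 2 := by gcongr
  have hq2 : ‖q‖ ^ 2 ≤ δ ^ 2 := by gcongr
  have hpq2 : ‖p - q‖ ^ 2 ≤ δ ^ 2 := by gcongr
  -- By polarization the left side of the goal is at most `b (‖p‖² + ‖q‖²) + 2 b ‖p - q‖²`, whence
  -- the constant 4.
  have h5 : 2 * (2 * b * ⟪p, q⟫) = 2 * b * (‖p‖ ^ 2 + ‖q‖ ^ 2 - ‖p - q‖ ^ 2) := by
    rw [h4]
    ring
  nlinarith [mul_le_mul_of_nonneg_left hp2 hb.le, mul_le_mul_of_nonneg_left hq2 hb.le,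
    mul_le_mul_of_nonneg_left hpq2 hb.le]

/-- The density of the uniform mixture of the Gaussian measures with means `m i`. -/
noncomputable def gaussMixture {ι : Type*} [Fintype ι] (b : ℝ) (m : ι → V) (y : V) : ℝ :=
  (Fintype.card ι : ℝ)⁻¹ * ∑ i, gaussDensity b (m i) y

lemma gaussMixture_pos {ι : Type*} [Fintype ι] [Nonempty ι] {b : ℝ} (hb : 0 < b) (m : ι → V)
    (y : V) : 0 < gaussMixture b m y :=
  mul_pos (by simp [Fintype.card_pos])
    (Finset.sum_pos (fun i _ => gaussDensity_pos hb _ _) Finset.univ_nonempty)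

lemma gaussMixture_sub {ι : Type*} [Fintype ι] (b : ℝ) {m m' : ι → V} {j : ι}
    (h : ∀ i, i ≠ j → m i = m' i) (y : V) :
    gaussMixture b m y - gaussMixture b m' y =
      (Fintype.card ι : ℝ)⁻¹ * (gaussDensity b (m j) y - gaussDensity b (m' j) y) := by
  unfold gaussMixture
  rw [← mul_sub, ← Finset.sum_sub_distrib, Finset.sum_eq_single j]
  · intro i _ hi
    rw [h i hi, sub_self]
  · simp

/-- The factor `8 n³` collects `n²` from `(P - Q)²`, `n` from averaging the inverses, 2 from the
harmonic mean and 4 from splitting `(P + Q)⁻¹`. -/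
lemma le_sqrt_gaussMixture_mul {ι : Type*} [Fintype ι] [Nonempty ι] {b : ℝ} (hb : 0 < b)
    {m m' : ι → V} {j : ι} (h : ∀ i, i ≠ j → m i = m' i) (y : V) :
    (gaussMixture b m y + gaussMixture b m' y) / 2 -
        (8 * (Fintype.card ι : ℝ) ^ 3)⁻¹ *
          ∑ i, ((gaussDensity b (m j) y - gaussDensity b (m' j) y) ^ 2 / gaussDensity b (m i) y +
            (gaussDensity b (m j) y - gaussDensity b (m' j) y) ^ 2 / gaussDensity b (m' i) y) ≤
      √(gaussMixture b m y * gaussMixture b m' y) := by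
  have hP := gaussMixture_pos hb m y
  have hQ := gaussMixture_pos hb m' y
  refine le_trans ?_ (sub_sq_div_le_sqrt_mul hP hQ)
  rw [gaussMixture_sub b h y]
  set D := gaussDensity b (m j) y - gaussDensity b (m' j) y
  set n : ℝ := (Fintype.card ι : ℝ)
  have hn : 0 < n := by
    have : 0 < Fintype.card ι := Fintype.card_pos
    exact Nat.cast_pos.2 this
  have h1 : (gaussMixture b m y)⁻¹ ≤ n⁻¹ * ∑ i, (gaussDensity b (m i) y)⁻¹ :=
    inv_mean_le_mean_inv fun i => gaussDensity_pos hb (m i) y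
  have h2 : (gaussMixture b m' y)⁻¹ ≤ n⁻¹ * ∑ i, (gaussDensity b (m' i) y)⁻¹ :=
    inv_mean_le_mean_inv fun i => gaussDensity_pos hb (m' i) y
  have h3 := inv_add_le hP hQ
  refine sub_le_sub_left ?_ _
  have hsum : ∑ i, (D ^ 2 / gaussDensity b (m i) y + D ^ 2 / gaussDensity b (m' i) y) =
      D ^ 2 * (∑ i, (gaussDensity b (m i) y)⁻¹ + ∑ i, (gaussDensity b (m' i) y)⁻¹) := by
    rw [← Finset.sum_add_distrib, Finset.mul_sum]
    exact Finset.sum_congr rfl fun i _ => by ring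
  rw [hsum]
  calc (n⁻¹ * D) ^ 2 / (2 * (gaussMixture b m y + gaussMixture b m' y))
      = n⁻¹ ^ 2 * D ^ 2 / 2 * (gaussMixture b m y + gaussMixture b m' y)⁻¹ := by
        field_simp
    _ ≤ n⁻¹ ^ 2 * D ^ 2 / 2 * ((n⁻¹ * ∑ i, (gaussDensity b (m i) y)⁻¹ +
          n⁻¹ * ∑ i, (gaussDensity b (m' i) y)⁻¹) / 4) := by
        gcongr
        linarith
    _ = _ := by
        field_simp
        ring

variable [FiniteDimensional ℝ V] [MeasurableSpace V] [BorelSpace V]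

lemma integrable_gaussDensity_sub_sq_div {b : ℝ} (hb : 0 < b) (x y c : V) :
    Integrable fun v => (gaussDensity b x v - gaussDensity b y v) ^ 2 / gaussDensity b c v := by
  simp_rw [gaussDensity_sub_sq_div hb]
  exact (((integrable_gaussDensity hb _).const_mul _).add
    ((integrable_gaussDensity hb _).const_mul _)).sub
      (((integrable_gaussDensity hb _).const_mul _).const_mul _)

lemma integral_gaussDensity_sub_sq_div_le {b δ : ℝ} (hb : 0 < b) (hδ : 2 * b * δ ^ 2 ≤ 1 / 2)
    {x y c : V} (hx : ‖x - c‖ ≤ δ) (hy : ‖y - c‖ ≤ δ) (hxy : ‖x - y‖ ≤ δ) :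
    ∫ v, (gaussDensity b x v - gaussDensity b y v) ^ 2 / gaussDensity b c v ≤ 4 * b * δ ^ 2 := by
  have hI := fun z : V => integrable_gaussDensity hb z
  simp_rw [gaussDensity_sub_sq_div hb]
  have hA : Integrable fun v => Real.exp (2 * b * ⟪x - c, x - c⟫) * gaussDensity b (x + x - c) v +
      Real.exp (2 * b * ⟪y - c, y - c⟫) * gaussDensity b (y + y - c) v :=
    ((hI _).const_mul _).add ((hI _).const_mul _)
  rw [integral_sub hA (((hI _).const_mul _).const_mul _), integral_add ((hI _).const_mul _) ((hI _).const_mul _)]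
  simp only [integral_const_mul, integral_gaussDensity hb, mul_one]
  exact exp_add_exp_sub_two_mul_exp_inner_le hb hδ hx hy (by simpa using hxy)

lemma integrable_gaussMixture {ι : Type*} [Fintype ι] {b : ℝ} (hb : 0 < b) (m : ι → V) :
    Integrable (gaussMixture b m) :=
  (integrable_finsetSum _ fun i _ => integrable_gaussDensity hb (m i)).const_mul _

lemma integral_gaussMixture {ι : Type*} [Fintype ι] [Nonempty ι] {b : ℝ} (hb : 0 < b)
    (m : ι → V) : ∫ y, gaussMixture b m y = 1 := by
  unfold gaussMixture
  rw [integral_const_mul, integral_finsetSum _ fun i _ => integrable_gaussDensity hb (m i)]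
  simp [integral_gaussDensity hb]

lemma ofReal_integral_le_lintegral_ofReal {α : Type*} [MeasurableSpace α] {μ : Measure α}
    {g : α → ℝ} (hg : Integrable g μ) :
    ENNReal.ofReal (∫ x, g x ∂μ) ≤ ∫⁻ x, ENNReal.ofReal (g x) ∂μ := by
  refine ENNReal.ofReal_le_of_le_toReal ?_
  rw [integral_eq_lintegral_pos_part_sub_lintegral_neg_part hg]
  exact sub_le_self _ ENNReal.toReal_nonneg

/-- The Hellinger affinity of two uniform mixtures of Gaussians that differ in one component and
whose means are close is at least `1 - b δ² / n²`. -/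
lemma one_sub_le_lintegral_gaussMixture {ι : Type*} [Fintype ι] [Nonempty ι] {b δ : ℝ}
    (hb : 0 < b) (hδ : 2 * b * δ ^ 2 ≤ 1 / 2) {m m' : ι → V} {j : ι}
    (h : ∀ i, i ≠ j → m i = m' i) (h1 : ∀ i, ‖m j - m i‖ ≤ δ) (h2 : ∀ i, ‖m j - m' i‖ ≤ δ)
    (h3 : ∀ i, ‖m' j - m i‖ ≤ δ) (h4 : ∀ i, ‖m' j - m' i‖ ≤ δ) :
    ENNReal.ofReal (1 - b * δ ^ 2 / (Fintype.card ι : ℝ) ^ 2) ≤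
      ∫⁻ y, ENNReal.ofReal (gaussMixture b m y) ^ (1 / 2 : ℝ) *
        ENNReal.ofReal (gaussMixture b m' y) ^ (1 / 2 : ℝ) := by
  set n : ℝ := (Fintype.card ι : ℝ) with hndef
  have hn : 0 < n := by
    have : 0 < Fintype.card ι := Fintype.card_pos
    exact Nat.cast_pos.2 this
  set G : V → ℝ := fun y => (gaussMixture b m y + gaussMixture b m' y) / 2 -
        (8 * n ^ 3)⁻¹ *
          ∑ i, ((gaussDensity b (m j) y - gaussDensity b (m' j) y) ^ 2 / gaussDensity b (m i) y +
            (gaussDensity b (m j) y - gaussDensity b (m' j) y) ^ 2 / gaussDensity b (m' i) y)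
    with hG
  have hI := fun c : V => integrable_gaussDensity_sub_sq_div hb (m j) (m' j) c
  have hIs : Integrable fun y => ∑ i : ι,
      ((gaussDensity b (m j) y - gaussDensity b (m' j) y) ^ 2 / gaussDensity b (m i) y +
        (gaussDensity b (m j) y - gaussDensity b (m' j) y) ^ 2 / gaussDensity b (m' i) y) :=
    integrable_finsetSum _ fun i _ => (hI (m i)).add (hI (m' i))
  have hIm : Integrable fun y => gaussMixture b m y + gaussMixture b m' y :=
    (integrable_gaussMixture hb m).add (integrable_gaussMixture hb m')
  have hIG : Integrable G := (hIm.div_const 2).sub (hIs.const_mul _)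
  have hGint : 1 - b * δ ^ 2 / n ^ 2 ≤ ∫ y, G y := by
    have e1 : ∫ y, (gaussMixture b m y + gaussMixture b m' y) / 2 = 1 := by
      rw [integral_div, integral_add (integrable_gaussMixture hb m) (integrable_gaussMixture hb m'),
        integral_gaussMixture hb, integral_gaussMixture hb]
      norm_num
    have e2 : ∫ y, ∑ i : ι,
        ((gaussDensity b (m j) y - gaussDensity b (m' j) y) ^ 2 / gaussDensity b (m i) y +
        (gaussDensity b (m j) y - gaussDensity b (m' j) y) ^ 2 / gaussDensity b (m' i) y) ≤
        n * (8 * b * δ ^ 2) := by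
      have hadd : ∀ i, Integrable fun y =>
          (gaussDensity b (m j) y - gaussDensity b (m' j) y) ^ 2 / gaussDensity b (m i) y +
          (gaussDensity b (m j) y - gaussDensity b (m' j) y) ^ 2 / gaussDensity b (m' i) y :=
        fun i => (hI (m i)).add (hI (m' i))
      rw [integral_finsetSum _ fun i _ => hadd i]
      calc _ ≤ ∑ _i : ι, 8 * b * δ ^ 2 := Finset.sum_le_sum fun i _ => by
            rw [integral_add (hI (m i)) (hI (m' i))]
            -- Each component of either mixture serves as the centre `c`; `h2 j` bounds the distance
            -- between the two differing means.
            have a1 := integral_gaussDensity_sub_sq_div_le hb hδ (h1 i) (h3 i) (h2 j)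
            have a2 := integral_gaussDensity_sub_sq_div_le hb hδ (h2 i) (h4 i) (h2 j)
            linarith
        _ = _ := by simp [hndef]
    rw [hG, integral_sub (hIm.div_const 2) (hIs.const_mul _), integral_const_mul, e1]
    refine sub_le_sub_left ?_ _
    calc _ ≤ (8 * n ^ 3)⁻¹ * (n * (8 * b * δ ^ 2)) := by gcongr
      _ = _ := by field_simp
  -- The lower bound `G` may be negative; truncation by `ENNReal.ofReal` only increases its
  -- integral.
  refine (ENNReal.ofReal_le_ofReal hGint).trans
    ((ofReal_integral_le_lintegral_ofReal hIG).trans (lintegral_mono fun y => ?_))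
  have hP := (gaussMixture_pos hb m y).le
  have hQ := (gaussMixture_pos hb m' y).le
  rw [ENNReal.ofReal_rpow_of_nonneg hP (by norm_num), ENNReal.ofReal_rpow_of_nonneg hQ (by norm_num),
    ← ENNReal.ofReal_mul (by positivity), ← Real.sqrt_eq_rpow, ← Real.sqrt_eq_rpow,
    ← Real.sqrt_mul hP]
  exact ENNReal.ofReal_le_ofReal (le_sqrt_gaussMixture_mul hb h y)

end MixtureAffinity

/-! ### Hellinger affinity along Markov transitions -/

section Affinity

open scoped ENNReal

variable {α : Type*} [MeasurableSpace α]

/-- The Hellinger affinity `∫ √p √q dμ` of two densities with respect to `μ`. -/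
noncomputable def hellingerAffinity (μ : Measure α) (p q : α → ℝ≥0∞) : ℝ≥0∞ :=
  ∫⁻ x, p x ^ (1 / 2 : ℝ) * q x ^ (1 / 2 : ℝ) ∂μ

lemma ENNReal.rpow_half_mul_rpow_half (a : ℝ≥0∞) : a ^ (1 / 2 : ℝ) * a ^ (1 / 2 : ℝ) = a := by
  rw [← ENNReal.rpow_add_of_nonneg _ _ (by norm_num) (by norm_num)]
  norm_num

lemma hellingerAffinity_self (μ : Measure α) (p : α → ℝ≥0∞) :
    hellingerAffinity μ p p = ∫⁻ x, p x ∂μ := by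
  simp only [hellingerAffinity, ENNReal.rpow_half_mul_rpow_half]

lemma hellingerAffinity_le (μ : Measure α) {p q : α → ℝ≥0∞} (hp : Measurable p)
    (hq : Measurable q) :
    hellingerAffinity μ p q ≤ (∫⁻ x, p x ∂μ) ^ (1 / 2 : ℝ) * (∫⁻ x, q x ∂μ) ^ (1 / 2 : ℝ) := by
  have h := ENNReal.lintegral_mul_le_Lp_mul_Lq μ Real.HolderConjugate.two_two
    (f := fun x => p x ^ (1 / 2 : ℝ)) (g := fun x => q x ^ (1 / 2 : ℝ))
    (by fun_prop) (by fun_prop)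
  have hsq : ∀ a : ℝ≥0∞, (a ^ (1 / 2 : ℝ)) ^ (2 : ℝ) = a := fun a => by
    rw [← ENNReal.rpow_mul]
    norm_num
  simp only [hsq] at h
  exact h

/-- If two Markov transition densities have affinity at least `c` at every point, then applying
them shrinks the affinity of two densities by a factor of at least `c`. -/
lemma mul_hellingerAffinity_le {μ : Measure α} [SFinite μ] {p q : α → ℝ≥0∞} (hp : Measurable p)
    (hq : Measurable q) {K K' : α → α → ℝ≥0∞} (hK : Measurable (Function.uncurry K))
    (hK' : Measurable (Function.uncurry K')) {c : ℝ≥0∞}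
    (hc : ∀ w, c ≤ hellingerAffinity μ (K w) (K' w)) :
    c * hellingerAffinity μ p q ≤
      hellingerAffinity μ (fun y => ∫⁻ w, p w * K w y ∂μ) fun y => ∫⁻ w, q w * K' w y ∂μ := by
  have hK1 : ∀ w, Measurable (K w) := fun w => hK.comp measurable_prodMk_left
  have hK1' : ∀ w, Measurable (K' w) := fun w => hK'.comp measurable_prodMk_left
  have hK2 : ∀ y, Measurable fun w => K w y := fun y => hK.comp measurable_prodMk_right
  have hK2' : ∀ y, Measurable fun w => K' w y := fun y => hK'.comp measurable_prodMk_right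
  have hmeas : Measurable (Function.uncurry fun w y =>
      (p w * K w y) ^ (1 / 2 : ℝ) * (q w * K' w y) ^ (1 / 2 : ℝ)) := by
    have h1 : Measurable fun x : α × α => p x.1 * Function.uncurry K x := by fun_prop
    have h2 : Measurable fun x : α × α => q x.1 * Function.uncurry K' x := by fun_prop
    exact (h1.pow_const _).mul (h2.pow_const _)
  calc c * hellingerAffinity μ p q
      = ∫⁻ w, (p w ^ (1 / 2 : ℝ) * q w ^ (1 / 2 : ℝ)) * c ∂μ := by
        rw [lintegral_mul_const _ (by fun_prop), mul_comm, hellingerAffinity]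
    _ ≤ ∫⁻ w, (p w ^ (1 / 2 : ℝ) * q w ^ (1 / 2 : ℝ)) *
          hellingerAffinity μ (K w) (K' w) ∂μ := by
        gcongr with w
        exact hc w
    _ = ∫⁻ w, ∫⁻ y, (p w * K w y) ^ (1 / 2 : ℝ) * (q w * K' w y) ^ (1 / 2 : ℝ) ∂μ ∂μ := by
        refine lintegral_congr fun w => ?_
        rw [hellingerAffinity, ← lintegral_const_mul _
          (((hK1 w).pow_const _).fun_mul ((hK1' w).pow_const _))]
        refine lintegral_congr fun y => ?_
        rw [ENNReal.mul_rpow_of_nonneg _ _ (by norm_num), ENNReal.mul_rpow_of_nonneg _ _ (by norm_num)]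
        ring
    _ = ∫⁻ y, ∫⁻ w, (p w * K w y) ^ (1 / 2 : ℝ) * (q w * K' w y) ^ (1 / 2 : ℝ) ∂μ ∂μ :=
        lintegral_lintegral_swap hmeas.aemeasurable
    -- Cauchy–Schwarz in `w`, for each fixed endpoint `y`.
    _ ≤ _ := lintegral_mono fun y => hellingerAffinity_le μ (hp.mul (hK2 y)) (hq.mul (hK2' y))

/-- A lower bound on the Hellinger affinity gives an upper bound on the squared Hellinger distance
of the densities of two probability measures. -/
lemma hellingerSq_rnDeriv_le {d : ℕ} {p q : EuclideanSpace ℝ (Fin d) → ℝ≥0∞} (hp : Measurable p)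
    (hq : Measurable q) (hp1 : ∫⁻ x, p x = 1) (hq1 : ∫⁻ x, q x = 1) {δ : ℝ}
    (hδ : ENNReal.ofReal (1 - δ) ≤ hellingerAffinity volume p q) :
    hellingerSq (fun w => ((volume.withDensity p).rnDeriv volume w).toReal)
      (fun w => ((volume.withDensity q).rnDeriv volume w).toReal) ≤ δ := by
  have hpP : (fun w => ((volume.withDensity p).rnDeriv volume w).toReal) =ᵐ[volume]
      fun w => (p w).toReal := by
    filter_upwards [Measure.rnDeriv_withDensity volume hp] with w hw
    rw [hw]
  have hqQ : (fun w => ((volume.withDensity q).rnDeriv volume w).toReal) =ᵐ[volume]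
      fun w => (q w).toReal := by
    filter_upwards [Measure.rnDeriv_withDensity volume hq] with w hw
    rw [hw]
  have hpi : Integrable fun w => (p w).toReal :=
    integrable_toReal_of_lintegral_ne_top hp.aemeasurable (by simp [hp1])
  have hqi : Integrable fun w => (q w).toReal :=
    integrable_toReal_of_lintegral_ne_top hq.aemeasurable (by simp [hq1])
  have hpt := ae_lt_top hp (by simp [hp1] : ∫⁻ x, p x ≠ ∞)
  have hqt := ae_lt_top hq (by simp [hq1] : ∫⁻ x, q x ≠ ∞)
  have hp2 : ∫ w, (p w).toReal = 1 := by
    rw [integral_toReal hp.aemeasurable hpt, hp1, ENNReal.toReal_one]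
  have hq2 : ∫ w, (q w).toReal = 1 := by
    rw [integral_toReal hq.aemeasurable hqt, hq1, ENNReal.toReal_one]
  have hsi : Integrable fun w => √(p w).toReal * √(q w).toReal := by
    refine (hpi.add hqi).mono' (by fun_prop) (.of_forall fun w => ?_)
    rw [Real.norm_of_nonneg (by positivity), Pi.add_apply]
    have h1 := Real.sq_sqrt (ENNReal.toReal_nonneg (a := p w))
    have h2 := Real.sq_sqrt (ENNReal.toReal_nonneg (a := q w))
    nlinarith [sq_nonneg (√(p w).toReal - √(q w).toReal), sq_nonneg √(p w).toReal,
      sq_nonneg √(q w).toReal]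
  have haff : hellingerAffinity volume p q =
      ENNReal.ofReal (∫ w, √(p w).toReal * √(q w).toReal) := by
    rw [ofReal_integral_eq_lintegral_ofReal hsi (.of_forall fun w => by positivity)]
    refine lintegral_congr_ae ?_
    filter_upwards [hpt, hqt] with w h1 h2
    rw [ENNReal.ofReal_mul (by positivity), Real.sqrt_eq_rpow, Real.sqrt_eq_rpow,
      ← ENNReal.ofReal_rpow_of_nonneg (by positivity) (by norm_num),
      ← ENNReal.ofReal_rpow_of_nonneg (by positivity) (by norm_num),
      ENNReal.ofReal_toReal h1.ne, ENNReal.ofReal_toReal h2.ne]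
  have hle : 1 - δ ≤ ∫ w, √(p w).toReal * √(q w).toReal := by
    rw [haff] at hδ
    exact (ENNReal.ofReal_le_ofReal_iff (integral_nonneg fun w => by positivity)).1 hδ
  have hexp : ∫ w, (√((volume.withDensity p).rnDeriv volume w).toReal -
      √((volume.withDensity q).rnDeriv volume w).toReal) ^ 2 =
      2 - 2 * ∫ w, √(p w).toReal * √(q w).toReal := by
    have hpq : Integrable fun w => (p w).toReal + (q w).toReal := hpi.add hqi
    calc _ = ∫ w, ((p w).toReal + (q w).toReal - 2 * (√(p w).toReal * √(q w).toReal)) := by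
          refine integral_congr_ae ?_
          filter_upwards [hpP, hqQ] with w h1 h2
          rw [h1, h2, sub_sq, Real.sq_sqrt ENNReal.toReal_nonneg,
            Real.sq_sqrt ENNReal.toReal_nonneg]
          ring
      _ = _ := by
          rw [integral_sub hpq (hsi.const_mul 2), integral_add hpi hqi, integral_const_mul, hp2,
            hq2]
          norm_num
  rw [hellingerSq, hexp]
  linarith

end Affinity

/-! ### Densities and affinity of the SGLD iterates -/

section SGLD

open scoped ENNReal

variable {𝒵 : Type*} {d n : ℕ}

lemma measurable_gradient {g : EuclideanSpace ℝ (Fin d) → ℝ} : Measurable (gradient g) :=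
  (LinearIsometryEquiv.continuous _).measurable.comp (measurable_fderiv ℝ g)

/-- The mean of an SGLD update from `w`, given the sampled index `i`. -/
noncomputable def sgldMean (f : EuclideanSpace ℝ (Fin d) → 𝒵 → ℝ) (S : Fin n → 𝒵) (η : ℝ)
    (w : EuclideanSpace ℝ (Fin d)) (i : Fin n) : EuclideanSpace ℝ (Fin d) :=
  w - η • gradient (fun v => f v (S i)) w

lemma measurable_sgldMean (f : EuclideanSpace ℝ (Fin d) → 𝒵 → ℝ) (S : Fin n → 𝒵) (η : ℝ)
    (i : Fin n) : Measurable fun w => sgldMean f S η w i :=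
  measurable_id.sub (measurable_gradient.const_smul η)

/-- The transition density of one SGLD update. -/
noncomputable def sgldKernel (f : EuclideanSpace ℝ (Fin d) → 𝒵 → ℝ) (S : Fin n → 𝒵) (β η : ℝ)
    (w y : EuclideanSpace ℝ (Fin d)) : ℝ≥0∞ :=
  ENNReal.ofReal (gaussMixture (1 / (2 * √(2 * η / β) ^ 2)) (sgldMean f S η w) y)

lemma measurable_sgldKernel (f : EuclideanSpace ℝ (Fin d) → 𝒵 → ℝ) (S : Fin n → 𝒵) (β η : ℝ) :
    Measurable (Function.uncurry (sgldKernel f S β η)) := by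
  have hm : ∀ i, Measurable fun x : EuclideanSpace ℝ (Fin d) × EuclideanSpace ℝ (Fin d) =>
      gaussDensity (1 / (2 * √(2 * η / β) ^ 2)) (sgldMean f S η x.1 i) x.2 := fun i =>
    Measurable.gaussDensity _ ((measurable_sgldMean f S η i).comp measurable_fst) measurable_snd
  have hsum := (Finset.measurable_fun_sum Finset.univ fun i _ => hm i).const_mul
    (Fintype.card (Fin n) : ℝ)⁻¹
  exact hsum.ennreal_ofReal

/-- The density of the SGLD iterates, given by the Chapman–Kolmogorov recursion. -/
noncomputable def sgldPdf (f : EuclideanSpace ℝ (Fin d) → 𝒵 → ℝ) (S : Fin n → 𝒵) (β σ₀ : ℝ)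
    (η : ℕ → ℝ) : ℕ → EuclideanSpace ℝ (Fin d) → ℝ≥0∞
  | 0 => fun y => ENNReal.ofReal (gaussDensity (1 / (2 * σ₀ ^ 2)) 0 y)
  | k + 1 => fun y => ∫⁻ w, sgldPdf f S β σ₀ η k w * sgldKernel f S β (η k) w y

lemma measurable_sgldPdf (f : EuclideanSpace ℝ (Fin d) → 𝒵 → ℝ) (S : Fin n → 𝒵) (β σ₀ : ℝ)
    (η : ℕ → ℝ) (k : ℕ) : Measurable (sgldPdf f S β σ₀ η k) := by
  induction k with
  | zero =>
    exact (Measurable.gaussDensity _ measurable_const measurable_id).ennreal_ofReal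
  | succ k ih =>
    exact Measurable.lintegral_prod_left
      ((ih.comp measurable_fst).mul (measurable_sgldKernel f S β (η k)))

lemma lintegral_uniformOn_univ {ι : Type*} [Fintype ι] [MeasurableSpace ι]
    [MeasurableSingletonClass ι] (h : ι → ℝ≥0∞) :
    ∫⁻ i, h i ∂(uniformOn (Set.univ : Set ι)) = (Fintype.card ι : ℝ≥0∞)⁻¹ * ∑ i, h i := by
  rw [uniformOn, ProbabilityTheory.cond, Measure.restrict_univ, lintegral_smul_measure, lintegral_count, tsum_fintype]
  simp

lemma lintegral_sgldStep [NeZero n] (f : EuclideanSpace ℝ (Fin d) → 𝒵 → ℝ) (S : Fin n → 𝒵)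
    {β η : ℝ} (hβ : 0 < β) (hη : 0 < η) (w : EuclideanSpace ℝ (Fin d))
    {h : EuclideanSpace ℝ (Fin d) → ℝ≥0∞} (hh : Measurable h) :
    ∫⁻ i, ∫⁻ b, h (sgldStep f β η w (S i) b) ∂(stdGaussian (EuclideanSpace ℝ (Fin d)))
        ∂(uniformOn (Set.univ : Set (Fin n))) =
      ∫⁻ y, sgldKernel f S β η w y * h y := by
  have hs : 0 < √(2 * η / β) := by positivity
  have hb : 0 < 1 / (2 * √(2 * η / β) ^ 2) := by positivity
  have hm : ∀ i, Measurable fun y =>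
      ENNReal.ofReal (gaussDensity (1 / (2 * √(2 * η / β) ^ 2)) (sgldMean f S η w i) y) :=
    fun i => (Measurable.gaussDensity _ measurable_const measurable_id).ennreal_ofReal
  have h1 : ∀ i, ∫⁻ b, h (sgldStep f β η w (S i) b) ∂(stdGaussian (EuclideanSpace ℝ (Fin d))) =
      ∫⁻ y, ENNReal.ofReal (gaussDensity (1 / (2 * √(2 * η / β) ^ 2)) (sgldMean f S η w i) y) *
        h y := fun i => lintegral_stdGaussian_add_smul hs _ hh
  simp_rw [h1]
  rw [lintegral_uniformOn_univ, ← lintegral_finsetSum _ fun i _ => (hm i).fun_mul hh,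
    ← lintegral_const_mul _ (Finset.measurable_fun_sum _ fun i _ => (hm i).fun_mul hh)]
  refine lintegral_congr fun y => ?_
  have hn : (0 : ℝ) < Fintype.card (Fin n) := by
    simpa using Nat.pos_of_neZero n
  rw [sgldKernel, gaussMixture, ENNReal.ofReal_mul (by positivity), ENNReal.ofReal_inv_of_pos hn,
    ENNReal.ofReal_natCast, ENNReal.ofReal_sum_of_nonneg fun i _ => (gaussDensity_pos hb _ _).le,
    mul_assoc, Finset.sum_mul]

/-- The index set is countable, so measurability in `w` for each fixed index suffices, and `𝒵` needs
no measurable structure. -/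
lemma measurable_sgldStep (f : EuclideanSpace ℝ (Fin d) → 𝒵 → ℝ) (S : Fin n → 𝒵) (β η : ℝ) :
    Measurable fun x : EuclideanSpace ℝ (Fin d) × Fin n × EuclideanSpace ℝ (Fin d) =>
      sgldStep f β η x.1 (S x.2.1) x.2.2 := by
  have h : Measurable fun x : EuclideanSpace ℝ (Fin d) × Fin n => sgldMean f S η x.1 x.2 :=
    measurable_from_prod_countable_left fun i => measurable_sgldMean f S η i
  exact (h.comp (measurable_fst.prodMk measurable_snd.fst)).add
    (measurable_snd.snd.const_smul √(2 * η / β))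

instance isProbabilityMeasure_sgldLaw [NeZero n] (f : EuclideanSpace ℝ (Fin d) → 𝒵 → ℝ)
    (S : Fin n → 𝒵) (β σ₀ : ℝ) (η : ℕ → ℝ) (k : ℕ) :
    IsProbabilityMeasure (sgldLaw f S β σ₀ η k) := by
  induction k with
  | zero => exact Measure.isProbabilityMeasure_map (by fun_prop)
  | succ k ih =>
    exact Measure.isProbabilityMeasure_map (measurable_sgldStep f S β (η k)).aemeasurable

/-- Chapman–Kolmogorov by induction: integrate an indicator against one update, then exchange the
integrals over `w` and `y` by Tonelli. -/
lemma sgldLaw_eq_withDensity [NeZero n] (f : EuclideanSpace ℝ (Fin d) → 𝒵 → ℝ) (S : Fin n → 𝒵)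
    {β σ₀ : ℝ} (hβ : 0 < β) (hσ₀ : 0 < σ₀) {η : ℕ → ℝ} {N : ℕ} (hη : ∀ k < N, 0 < η k) :
    sgldLaw f S β σ₀ η N = volume.withDensity (sgldPdf f S β σ₀ η N) := by
  induction N with
  | zero => exact map_smul_stdGaussian hσ₀
  | succ k ih =>
    have ih := ih fun j hj => hη j (by omega)
    have hstep := measurable_sgldStep f S β (η k)
    have hpdf := measurable_sgldPdf f S β σ₀ η k
    have hker := measurable_sgldKernel f S β (η k)
    ext A hA
    have hind : Measurable (A.indicator (1 : EuclideanSpace ℝ (Fin d) → ℝ≥0∞)) :=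
      measurable_one.indicator hA
    have hcomp : Measurable fun x : EuclideanSpace ℝ (Fin d) × Fin n × EuclideanSpace ℝ (Fin d) =>
        A.indicator (1 : EuclideanSpace ℝ (Fin d) → ℝ≥0∞)
          (sgldStep f β (η k) x.1 (S x.2.1) x.2.2) := hind.comp hstep
    rw [← lintegral_indicator_one hA, sgldLaw, lintegral_map hind hstep,
      lintegral_prod _ hcomp.aemeasurable]
    have hinner : ∀ w, ∫⁻ x, A.indicator 1 (sgldStep f β (η k) w (S x.1) x.2)
        ∂((uniformOn (Set.univ : Set (Fin n))).prod (stdGaussian (EuclideanSpace ℝ (Fin d)))) =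
        ∫⁻ y, sgldKernel f S β (η k) w y * A.indicator 1 y := by
      intro w
      rw [lintegral_prod _ (show Measurable fun x : Fin n × EuclideanSpace ℝ (Fin d) =>
          A.indicator (1 : EuclideanSpace ℝ (Fin d) → ℝ≥0∞) (sgldStep f β (η k) w (S x.1) x.2) from
            hcomp.comp measurable_prodMk_left).aemeasurable,
        ← lintegral_sgldStep f S hβ (hη k (by omega)) w hind]
    simp_rw [hinner]
    have hm : Measurable (Function.uncurry fun w y =>
        sgldPdf f S β σ₀ η k w * (sgldKernel f S β (η k) w y * A.indicator 1 y)) :=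
      (hpdf.comp measurable_fst).mul (hker.mul (hind.comp measurable_snd))
    have hm2 : Measurable fun w => ∫⁻ y, sgldKernel f S β (η k) w y * A.indicator 1 y :=
      Measurable.lintegral_prod_right (f := fun w y => sgldKernel f S β (η k) w y *
        A.indicator 1 y) (hker.mul (hind.comp measurable_snd))
    rw [ih, lintegral_withDensity_eq_lintegral_mul _ hpdf hm2, withDensity_apply _ hA,
      ← lintegral_indicator hA]
    calc _ = ∫⁻ w, ∫⁻ y, sgldPdf f S β σ₀ η k w *
            (sgldKernel f S β (η k) w y * A.indicator 1 y) := by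
          refine lintegral_congr fun w => ?_
          rw [Pi.mul_apply, lintegral_const_mul]
          exact (hker.comp measurable_prodMk_left).mul hind
      _ = ∫⁻ y, ∫⁻ w, sgldPdf f S β σ₀ η k w *
            (sgldKernel f S β (η k) w y * A.indicator 1 y) :=
          lintegral_lintegral_swap hm.aemeasurable
      _ = _ := by
          refine lintegral_congr fun y => ?_
          by_cases hy : y ∈ A
          · simp [hy, sgldPdf]
          · simp [hy]

lemma lintegral_sgldPdf [NeZero n] (f : EuclideanSpace ℝ (Fin d) → 𝒵 → ℝ) (S : Fin n → 𝒵)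
    {β σ₀ : ℝ} (hβ : 0 < β) (hσ₀ : 0 < σ₀) {η : ℕ → ℝ} {N : ℕ} (hη : ∀ k < N, 0 < η k) :
    ∫⁻ y, sgldPdf f S β σ₀ η N y = 1 := by
  rw [← setLIntegral_univ, ← withDensity_apply _ .univ, ← sgldLaw_eq_withDensity f S hβ hσ₀ hη]
  exact measure_univ

lemma one_sub_le_hellingerAffinity_sgldKernel [NeZero n] (f : EuclideanSpace ℝ (Fin d) → 𝒵 → ℝ)
    {L : ℝ} (hL : ∀ z z' w, ‖gradient (fun v => f v z) w - gradient (fun v => f v z') w‖ ≤ L)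
    {S S' : Fin n → 𝒵} (hS : Neighboring S S') {β η : ℝ} (hβ : 0 < β) (hη : 0 < η)
    (hηL : η * (β * L ^ 2) ≤ 1) (w : EuclideanSpace ℝ (Fin d)) :
    ENNReal.ofReal (1 - β * L ^ 2 / (4 * n ^ 2) * η) ≤
      hellingerAffinity volume (sgldKernel f S β η w) (sgldKernel f S' β η w) := by
  obtain ⟨j, -, hj⟩ := hS
  have hmean : ∀ (T T' : Fin n → 𝒵) (i i' : Fin n),
      ‖sgldMean f T η w i - sgldMean f T' η w i'‖ ≤ η * L := by
    intro T T' i i'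
    have : sgldMean f T η w i - sgldMean f T' η w i' =
        η • (gradient (fun v => f v (T' i')) w - gradient (fun v => f v (T i)) w) := by
      rw [sgldMean, sgldMean, smul_sub]
      abel
    rw [this, norm_smul, Real.norm_of_nonneg hη.le]
    exact mul_le_mul_of_nonneg_left (hL _ _ _) hη.le
  have hb : 1 / (2 * √(2 * η / β) ^ 2) = β / (4 * η) := by
    rw [Real.sq_sqrt (by positivity)]
    field_simp
    norm_num
  have h := one_sub_le_lintegral_gaussMixture (b := 1 / (2 * √(2 * η / β) ^ 2)) (δ := η * L)
    (m := sgldMean f S η w) (m' := sgldMean f S' η w) (j := j) (by positivity)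
    (by
      -- With `b = β / (4 η)` and `δ = η L`, smallness of `2 b δ²` is exactly `η β L² ≤ 1`.
      rw [hb]
      have : 2 * (β / (4 * η)) * (η * L) ^ 2 = η * (β * L ^ 2) / 2 := by
        field_simp
        ring
      linarith)
    (fun i hi => by
      have : S i = S' i := by
        by_contra hne
        exact hi (hj i hne)
      rw [sgldMean, sgldMean, this])
    (fun _ => hmean _ _ _ _) (fun _ => hmean _ _ _ _) (fun _ => hmean _ _ _ _)
    (fun _ => hmean _ _ _ _)
  have hε : β * L ^ 2 / (4 * n ^ 2) * η =
      1 / (2 * √(2 * η / β) ^ 2) * (η * L) ^ 2 / (Fintype.card (Fin n) : ℝ) ^ 2 := by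
    have hn : (n : ℝ) ≠ 0 := Nat.cast_ne_zero.2 (NeZero.ne n)
    rw [hb, Fintype.card_fin]
    field_simp
  rw [hε]
  exact h

lemma one_sub_le_hellingerAffinity_sgldPdf [NeZero n] (f : EuclideanSpace ℝ (Fin d) → 𝒵 → ℝ)
    {L : ℝ} (hL : ∀ z z' w, ‖gradient (fun v => f v z) w - gradient (fun v => f v z') w‖ ≤ L)
    {S S' : Fin n → 𝒵} (hS : Neighboring S S') {β σ₀ : ℝ} (hβ : 0 < β) (hσ₀ : 0 < σ₀)
    {η : ℕ → ℝ} {N : ℕ} (hη : ∀ k < N, 0 < η k) (hηL : ∀ k < N, η k * (β * L ^ 2) ≤ 1) :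
    ENNReal.ofReal (1 - β * L ^ 2 / (4 * n ^ 2) * ∑ k ∈ Finset.range N, η k) ≤
      hellingerAffinity volume (sgldPdf f S β σ₀ η N) (sgldPdf f S' β σ₀ η N) := by
  induction N with
  | zero =>
    have h0 : sgldPdf f S' β σ₀ η 0 = sgldPdf f S β σ₀ η 0 := rfl
    rw [h0, hellingerAffinity_self, lintegral_sgldPdf f S hβ hσ₀ hη]
    simp
  | succ N ih =>
    have ih := ih (fun k hk => hη k (by omega)) (fun k hk => hηL k (by omega))
    have hηN := hη N (by omega)
    have hker := one_sub_le_hellingerAffinity_sgldKernel f hL hS hβ hηN (hηL N (by omega))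
    refine le_trans ?_ ((mul_le_mul_right ih _).trans (mul_hellingerAffinity_le
      (measurable_sgldPdf f S β σ₀ η N) (measurable_sgldPdf f S' β σ₀ η N)
      (measurable_sgldKernel f S β (η N)) (measurable_sgldKernel f S' β (η N)) hker))
    set c := β * L ^ 2 / (4 * (n : ℝ) ^ 2) with hc
    have hc0 : 0 ≤ c := by positivity
    -- Only the new factor `1 - c * η N` must be nonnegative to merge the two `ENNReal.ofReal`
    -- factors; the accumulated one may be negative.
    have hcη : c * η N ≤ 1 := by
      have hn : (1 : ℝ) ≤ n := by exact_mod_cast Nat.pos_of_neZero n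
      have h4 : (1 : ℝ) ≤ 4 * n ^ 2 := by nlinarith
      calc c * η N = η N * (β * L ^ 2) / (4 * n ^ 2) := by rw [hc]; ring
        _ ≤ 1 := (div_le_one (by linarith)).2 ((hηL N (by omega)).trans h4)
    rw [Finset.sum_range_succ, ← ENNReal.ofReal_mul (by linarith)]
    refine ENNReal.ofReal_le_ofReal ?_
    have hsum : 0 ≤ ∑ k ∈ Finset.range N, η k :=
      Finset.sum_nonneg fun k hk => (hη k (by have := Finset.mem_range.1 hk; omega)).le
    have := mul_nonneg (mul_nonneg hc0 hηN.le) (mul_nonneg hc0 hsum)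
    nlinarith

end SGLD

theorem lemma2 {𝒵 : Type*} {d n : ℕ} (f : EuclideanSpace ℝ (Fin d) → 𝒵 → ℝ)
    (hf : ∀ z, Differentiable ℝ (fun w => f w z))
    (L : ℝ)
    (hL : ∀ z z' w, ‖gradient (fun v => f v z) w - gradient (fun v => f v z') w‖ ≤ L)
    (S S' : Fin n → 𝒵) (hS : Neighboring S S')
    (β σ₀ : ℝ) (hβ : 0 < β) (hσ₀ : 0 < σ₀)
    (N : ℕ) (η : ℕ → ℝ) (hη_pos : ∀ k < N, 0 < η k)
    (hη : ∀ k < N, η k * (β * L ^ 2) ≤ Real.log 2) :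
    sgldLaw f S β σ₀ η N ≪ volume ∧ sgldLaw f S' β σ₀ η N ≪ volume ∧
      √(hellingerSq (sgldDensity f S β σ₀ η N) (sgldDensity f S' β σ₀ η N)) ≤
        √β * L / (2 * n) * √(∑ k ∈ Finset.range N, η k) := by
  obtain ⟨j, -⟩ := hS.exists
  have : NeZero n := ⟨fun h => by subst h; exact j.elim0⟩
  have hL0 : 0 ≤ L := (norm_nonneg _).trans (hL (S j) (S j) 0)
  -- The argument only needs the threshold 1, and `log 2 < 1`.
  have hηL : ∀ k < N, η k * (β * L ^ 2) ≤ 1 := fun k hk =>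
    (hη k hk).trans (by linarith [Real.log_two_lt_d9])
  have h := hellingerSq_rnDeriv_le (measurable_sgldPdf f S β σ₀ η N)
    (measurable_sgldPdf f S' β σ₀ η N) (lintegral_sgldPdf f S hβ hσ₀ hη_pos)
    (lintegral_sgldPdf f S' hβ hσ₀ hη_pos)
    (one_sub_le_hellingerAffinity_sgldPdf f hL hS hβ hσ₀ hη_pos hηL)
  rw [← sgldLaw_eq_withDensity f S hβ hσ₀ hη_pos, ← sgldLaw_eq_withDensity f S' hβ hσ₀ hη_pos] at h
  refine ⟨?_, ?_, ?_⟩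
  · rw [sgldLaw_eq_withDensity f S hβ hσ₀ hη_pos]
    exact withDensity_absolutelyContinuous _ _
  · rw [sgldLaw_eq_withDensity f S' hβ hσ₀ hη_pos]
    exact withDensity_absolutelyContinuous _ _
  · have hsum : 0 ≤ ∑ k ∈ Finset.range N, η k :=
      Finset.sum_nonneg fun k hk => (hη_pos k (Finset.mem_range.1 hk)).le
    refine Real.sqrt_le_iff.2 ⟨by positivity, h.trans_eq ?_⟩
    rw [mul_pow, div_pow, mul_pow, mul_pow, Real.sq_sqrt hβ.le, Real.sq_sqrt hsum]
    norm_num
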